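/- Let $n\ge 2$ and let $\mathscr R$ be a family of standard dyadic rectangles in $\mathbb R^n$, i.e. of sets of the form $\prod_{i=1}^n[0,2^{-m_i}]$ with $m_1,\dots,m_n\in\mathbb N=\{0,1,2,\dots\}$. For a measurable function $f:\mathbb R^n\to\mathbb R$ and $x\in\mathbb R^n$ let $$M_{\mathscr R}f(x):=\sup\left\{\frac1{|R|}\int_{\tau(R)}|f| : R\in\mathscr R,\ \tau \text{ a translation of } \mathbb R^n,\ x\in\tau(R)\right\}\in[0,\infty]$$ (with $\sup\emptyset=0$). Assume that there is a projection $p:\mathbb R^n\to\mathbb R^2$, $p(x)=(x_i,x_j)$ with $i\ne j$, onto one of the coordinate planes such that the family $\{p(R):R\in\mathscr R\}$ has finite width, i.e. is a finite union of families each of which is totally ordered by inclusion. Then there exists a constant $c>0$ such that, for every measurable $f:\mathbb R^n\to\mathbb R$ and every $\lambda>0$, $$|\{x\in\mathbb R^n: M_{\mathscr R}f(x)>\lambda\}|\le c\int_{\mathbb R^n}\frac{|f|}{\lambda}\left(1+\log_+^{n-2}\frac{|f|}{\lambda}\right),$$ where $|\cdot|$ of a set is Lebesgue measure, $\log_+^{n-2}s=(\log_+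 s)^{n-2}$ (equal to $1$ for $n=2$), and $\log_+ s=\max(\log s,0)$ for $s>0$, $\log_+0=0$. -/

import Mathlib

open MeasureTheory

/-- The standard dyadic rectangles of `ℝⁿ`: the products `∏ i, [0, 2 ^ (-m i)]` with `m i ∈ ℕ`. -/
def IsStandardDyadicRectangle {n : ℕ} (R : Set (Fin n → ℝ)) : Prop :=
  ∃ m : Fin n → ℕ, R = Set.univ.pi fun i => Set.Icc (0 : ℝ) ((2 ^ m i)⁻¹)

/-- A family of sets has finite width if it is a finite union of subfamilies that are totally
ordered by inclusion. -/
def HasFiniteWidth {E : Type*} (F : Set (Set E)) : Prop :=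
  ∃ (N : ℕ) (C : Fin N → Set (Set E)),
    (∀ k, IsChain (fun A B : Set E => A ⊆ B) (C k)) ∧ F = ⋃ k, C k

/-- The projection `x ↦ (x i, x j)` of `ℝⁿ` to the `x_i x_j` plane. -/
def coordPlaneProj {n : ℕ} (i j : Fin n) (x : Fin n → ℝ) : Fin 2 → ℝ :=
  ![x i, x j]

/-- The maximal operator of a family `F` of sets: the supremum of the averages of `|f|` over all
translates `v + R` of members `R` of `F` such that `v + R` contains `x`. -/
noncomputable def maximalOperator {n : ℕ} (F : Set (Set (Fin n → ℝ)))
    (f : (Fin n → ℝ) → ℝ) (x : Fin n → ℝ) : ENNReal :=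
  ⨆ (R : Set (Fin n → ℝ)) (_ : R ∈ F) (v : Fin n → ℝ) (_ : x ∈ (fun y => v + y) '' R),
    (volume R)⁻¹ * ∫⁻ y in (fun y => v + y) '' R, ENNReal.ofReal |f y|

/-- The uniform probability measure on `[-2 ^ (-k), 2 ^ (-k)]`. -/
noncomputable def unifInterval (k : ℕ) : Measure ℝ :=
  (ENNReal.ofReal (2 * (2 ^ k)⁻¹))⁻¹ •
    volume.restrict (Set.Icc (-((2 : ℝ) ^ k)⁻¹) ((2 ^ k)⁻¹))

instance (k : ℕ) : IsProbabilityMeasure (unifInterval k) := by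
  constructor
  simp only [unifInterval, Measure.smul_apply, smul_eq_mul, Measure.restrict_apply_univ,
    Real.volume_Icc, sub_neg_eq_add, ← two_mul]
  exact ENNReal.inv_mul_cancel (by simp) ENNReal.ofReal_ne_top

section Average

variable {ι : Type*} [Fintype ι]

/-- The uniform probability measure on the box `∏ i, [-2 ^ (-m i), 2 ^ (-m i)]`. -/
noncomputable def boxProb (m : ι → ℕ) : Measure (ι → ℝ) :=
  Measure.pi fun i => unifInterval (m i)

instance (m : ι → ℕ) : IsProbabilityMeasure (boxProb m) := by
  unfold boxProb; infer_instance

/-- The box with centre `x` and half side lengths `a * 2 ^ (-m i)`. -/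
def centredBox (a : ℝ) (x : ι → ℝ) (m : ι → ℕ) : Set (ι → ℝ) :=
  Set.univ.pi fun i => Set.Icc (x i - a * (2 ^ m i)⁻¹) (x i + a * (2 ^ m i)⁻¹)

lemma measurableSet_centredBox (a : ℝ) (x : ι → ℝ) (m : ι → ℕ) :
    MeasurableSet (centredBox a x m) :=
  MeasurableSet.univ_pi fun _ => measurableSet_Icc

lemma volume_centredBox (a : ℝ) (x : ι → ℝ) (m : ι → ℕ) :
    volume (centredBox a x m) = ∏ i, ENNReal.ofReal (2 * (a * (2 ^ m i)⁻¹)) := by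
  rw [centredBox, volume_pi_pi]
  refine Finset.prod_congr rfl fun i _ => ?_
  rw [Real.volume_Icc]
  congr 1
  ring

lemma volume_centredBox_two (x : ι → ℝ) (m : ι → ℕ) :
    volume (centredBox 2 x m) = 2 ^ Fintype.card ι * volume (centredBox 1 x m) := by
  rw [volume_centredBox, volume_centredBox, Fintype.card, ← Finset.prod_const,
    ← Finset.prod_mul_distrib]
  refine Finset.prod_congr rfl fun i _ => ?_
  rw [one_mul, ENNReal.ofReal_mul zero_le_two]
  simp

lemma boxProb_eq (m : ι → ℕ) :
    boxProb m = (volume (centredBox 1 0 m))⁻¹ • volume.restrict (centredBox 1 0 m) := by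
  rw [boxProb]
  refine Measure.pi_eq fun s hs => ?_
  rw [Measure.smul_apply, Measure.restrict_apply (MeasurableSet.univ_pi hs), centredBox,
    ← Set.pi_inter_distrib, volume_pi_pi, volume_pi_pi, smul_eq_mul,
    ENNReal.prod_inv_distrib, ← Finset.prod_mul_distrib]
  · refine Finset.prod_congr rfl fun i _ => ?_
    simp only [unifInterval, Measure.smul_apply, smul_eq_mul, Measure.restrict_apply (hs i),
      Real.volume_Icc, one_mul, Pi.zero_apply, zero_sub, zero_add, sub_neg_eq_add, ← two_mul]
  · intro i _ j _ _
    right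
    simp

lemma lintegral_boxProb_add (m : ι → ℕ) (g : (ι → ℝ) → ENNReal) (x : ι → ℝ) :
    ∫⁻ t, g (x + t) ∂boxProb m =
      (volume (centredBox 1 x m))⁻¹ * ∫⁻ y in centredBox 1 x m, g y := by
  have hpre : (fun t => x + t) ⁻¹' centredBox 1 x m = centredBox 1 0 m := by
    ext t
    simp only [centredBox, Set.mem_preimage, Set.mem_univ_pi, Set.mem_Icc, Pi.add_apply,
      Pi.zero_apply]
    refine forall_congr' fun i => ?_
    constructor <;> rintro ⟨h₁, h₂⟩ <;> constructor <;> linarith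
  rw [boxProb_eq, lintegral_smul_measure, smul_eq_mul, volume_centredBox, ← volume_centredBox 1 x,
    ← hpre, (measurePreserving_add_left volume x).setLIntegral_comp_preimage_emb
      (MeasurableEquiv.addLeft x).measurableEmbedding]

/-- The weak type `(1, 1)` inequality for averages over a totally ordered family of boxes. -/
lemma volume_lt_average_le (C : Set (ι → ℕ)) (hC : IsChain (· ≤ ·) C)
    (g : (ι → ℝ) → ENNReal) (s : ENNReal) (hs : s ≠ 0) (hs' : s ≠ ⊤) :
    volume {x | ∃ m ∈ C, s < ∫⁻ t, g (x + t) ∂boxProb m} ≤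
      2 ^ Fintype.card ι * s⁻¹ * ∫⁻ x, g x := by
  let T : Set ((ι → ℝ) × (ι → ℕ)) := {a | a.2 ∈ C ∧ s < ∫⁻ t, g (a.1 + t) ∂boxProb a.2}
  let B : (ι → ℝ) × (ι → ℕ) → Set (ι → ℝ) := fun a => centredBox 1 a.1 a.2
  have hpos (a : ℝ) (ha : 0 < a) (k : ℕ) : 0 < a * (2 ^ k)⁻¹ := by positivity
  obtain ⟨u, huT, hdisj, hcov⟩ := Vitali.exists_disjoint_subfamily_covering_enlargement B T
    (fun a => (2 ^ ∑ i, a.2 i)⁻¹) (3 / 2) (by norm_num) (fun a _ => by positivity) 1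
    (fun a _ => inv_le_one_of_one_le₀ (one_le_pow₀ one_le_two))
    (fun a _ => ⟨a.1, fun i _ => by
      have := hpos 1 one_pos (a.2 i)
      constructor <;> linarith⟩)
  have hcount : u.Countable := hdisj.countable_of_nonempty_interior fun a _ => by
    refine ⟨a.1, ?_⟩
    simp only [B, centredBox]
    rw [interior_pi_set Set.finite_univ]
    intro i _
    have := hpos 1 one_pos (a.2 i)
    simp only [interior_Icc, Set.mem_Ioo]
    constructor <;> linarith
  have hsub : {x | ∃ m ∈ C, s < ∫⁻ t, g (x + t) ∂boxProb m} ⊆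
      ⋃ b ∈ u, centredBox 2 b.1 b.2 := by
    rintro x ⟨m, hm, hx⟩
    obtain ⟨b, hb, ⟨z, hz₁, hz₂⟩, hle⟩ := hcov (x, m) ⟨hm, hx⟩
    refine Set.mem_biUnion hb fun i _ => ?_
    have hbm : b.2 ≤ m := by
      rcases hC.total (huT hb).1 hm with h | h
      · exact h
      by_contra hne
      have hlt : ∑ i, m i < ∑ i, b.2 i := by
        refine Finset.sum_lt_sum (fun i _ => h i) ?_
        by_contra! hcon
        exact hne fun i => hcon i (Finset.mem_univ i)
      have h2 : (2 : ℝ) ^ (∑ i, m i + 1) ≤ 2 ^ ∑ i, b.2 i :=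
        pow_le_pow_right₀ one_le_two hlt
      have hp : (0 : ℝ) < 2 ^ ∑ i, m i := by positivity
      have hp' : (0 : ℝ) < 2 ^ ∑ i, b.2 i := by positivity
      simp only at hle
      rw [← div_eq_mul_inv, inv_eq_one_div, div_le_div_iff₀ hp hp'] at hle
      rw [pow_succ] at h2
      linarith
    have h1 := hz₁ i trivial
    have h2 := hz₂ i trivial
    have h3 : ((2 : ℝ) ^ m i)⁻¹ ≤ (2 ^ b.2 i)⁻¹ :=
      inv_anti₀ (by positivity) (pow_le_pow_right₀ one_le_two (hbm i))
    simp only [Set.mem_Icc] at h1 h2 ⊢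
    constructor <;> linarith
  calc volume {x | ∃ m ∈ C, s < ∫⁻ t, g (x + t) ∂boxProb m}
      ≤ ∑' b : u, volume (centredBox 2 b.1.1 b.1.2) :=
        (measure_mono hsub).trans (measure_biUnion_le _ hcount _)
    _ ≤ ∑' b : u, 2 ^ Fintype.card ι * s⁻¹ * ∫⁻ y in B b.1, g y := by
        refine ENNReal.tsum_le_tsum fun b => ?_
        have hb := (huT b.2).2
        rw [lintegral_boxProb_add, mul_comm, ← div_eq_mul_inv] at hb
        have h4 := ENNReal.mul_le_of_le_div hb.le
        rw [volume_centredBox_two, mul_assoc]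
        gcongr
        rw [mul_comm, ← div_eq_mul_inv, ENNReal.le_div_iff_mul_le (Or.inl hs) (Or.inl hs'),
          mul_comm]
        exact h4
    _ = 2 ^ Fintype.card ι * s⁻¹ * ∫⁻ y in ⋃ b ∈ u, B b, g y := by
        rw [ENNReal.tsum_mul_left, lintegral_biUnion hcount
          (fun b _ => measurableSet_centredBox _ _ _) hdisj]
    _ ≤ _ := by
        gcongr
        exact Measure.restrict_le_self

end Average

section Partial

variable {ι : Type*} [DecidableEq ι]

lemma measurable_piecewise_zero (I : Finset ι) :
    Measurable fun t : ι → ℝ => (I.piecewise t 0 : ι → ℝ) := by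
  refine measurable_pi_lambda _ fun i => ?_
  by_cases hi : i ∈ I
  · simpa [hi] using measurable_pi_apply i
  · simp [hi]

variable [Fintype ι]

/-- The average of `g` over the box with centre `x` and half side lengths `2 ^ (-m i)` in the
directions `i ∈ I`, all other coordinates being kept fixed. -/
noncomputable def partialAverage (I : Finset ι) (m : ι → ℕ) (g : (ι → ℝ) → ENNReal)
    (x : ι → ℝ) : ENNReal :=
  ∫⁻ t, g (x + I.piecewise t 0) ∂boxProb m

/-- The maximal operator over the partial averages in the directions of `I` with scales in `C`. -/
noncomputable def partialMaximal (I : Finset ι) (C : Set (ι → ℕ)) (g : (ι → ℝ) → ENNReal)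
    (x : ι → ℝ) : ENNReal :=
  ⨆ m ∈ C, partialAverage I m g x

lemma measurable_partialAverage (I : Finset ι) (m : ι → ℕ) {g : (ι → ℝ) → ENNReal}
    (hg : Measurable g) : Measurable (partialAverage I m g) := by
  have h : Measurable fun p : (ι → ℝ) × (ι → ℝ) => g (p.1 + I.piecewise p.2 0) :=
    hg.comp (measurable_fst.add ((measurable_piecewise_zero I).comp measurable_snd))
  exact h.lintegral_prod_right'

lemma measurable_partialMaximal (I : Finset ι) (C : Set (ι → ℕ)) {g : (ι → ℝ) → ENNReal}
    (hg : Measurable g) : Measurable (partialMaximal I C g) :=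
  Measurable.biSup _ C.to_countable fun m _ => measurable_partialAverage I m hg

lemma partialAverage_mono (I : Finset ι) (m : ι → ℕ) {g h : (ι → ℝ) → ENNReal}
    (hgh : ∀ x, g x ≤ h x) (x : ι → ℝ) : partialAverage I m g x ≤ partialAverage I m h x :=
  lintegral_mono fun _ => hgh _

lemma partialAverage_const_mul (I : Finset ι) (m : ι → ℕ) {g : (ι → ℝ) → ENNReal}
    (hg : Measurable g) (c : ENNReal) (x : ι → ℝ) :
    partialAverage I m (fun y => c * g y) x = c * partialAverage I m g x :=
  lintegral_const_mul c (hg.comp ((measurable_piecewise_zero I).const_add x))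

lemma partialMaximal_const_mul (I : Finset ι) (C : Set (ι → ℕ)) {g : (ι → ℝ) → ENNReal}
    (hg : Measurable g) (c : ENNReal) (x : ι → ℝ) :
    partialMaximal I C (fun y => c * g y) x = c * partialMaximal I C g x := by
  simp only [partialMaximal, partialAverage_const_mul I _ hg, ENNReal.mul_iSup]

lemma partialAverage_empty (m : ι → ℕ) (g : (ι → ℝ) → ENNReal) (x : ι → ℝ) :
    partialAverage ∅ m g x = g x := by
  simp [partialAverage]

lemma map_piecewise_boxProb (I : Finset ι) (m : ι → ℕ) :
    MeasurePreserving (fun p : (ι → ℝ) × (ι → ℝ) => (I.piecewise p.1 p.2 : ι → ℝ))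
      ((boxProb m).prod (boxProb m)) (boxProb m) := by
  have hmeas : Measurable fun p : (ι → ℝ) × (ι → ℝ) => (I.piecewise p.1 p.2 : ι → ℝ) := by
    refine measurable_pi_lambda _ fun i => ?_
    by_cases hi : i ∈ I
    · simp only [hi, Finset.piecewise_eq_of_mem]
      exact (measurable_pi_apply i).comp measurable_fst
    · simp only [hi, not_false_eq_true, Finset.piecewise_eq_of_notMem]
      exact (measurable_pi_apply i).comp measurable_snd
  refine ⟨hmeas, (Measure.pi_eq fun s hs => ?_).symm⟩
  have hpre : (fun p : (ι → ℝ) × (ι → ℝ) => (I.piecewise p.1 p.2 : ι → ℝ)) ⁻¹' Set.univ.pi s =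
      (Set.univ.pi fun i => if i ∈ I then s i else Set.univ) ×ˢ
        (Set.univ.pi fun i => if i ∈ I then Set.univ else s i) := by
    ext p
    simp only [Set.mem_preimage, Set.mem_prod, Set.mem_univ_pi, ← forall_and]
    refine forall_congr' fun i => ?_
    by_cases hi : i ∈ I <;> simp [hi]
  rw [Measure.map_apply hmeas (MeasurableSet.univ_pi hs), hpre, Measure.prod_prod, boxProb,
    Measure.pi_pi, Measure.pi_pi, ← Finset.prod_mul_distrib]
  refine Finset.prod_congr rfl fun i _ => ?_
  by_cases hi : i ∈ I <;> simp [hi]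

/-- Averaging over a box is the same as averaging successively over complementary sets of
directions. -/
lemma partialAverage_union {I J : Finset ι} (hIJ : Disjoint I J) (m : ι → ℕ)
    {g : (ι → ℝ) → ENNReal} (hg : Measurable g) (x : ι → ℝ) :
    partialAverage (I ∪ J) m g x = partialAverage I m (partialAverage J m g) x := by
  have h₁ : Measurable fun t : ι → ℝ => g (x + (I ∪ J).piecewise t 0) :=
    hg.comp ((measurable_piecewise_zero _).const_add x)
  rw [partialAverage, ← (map_piecewise_boxProb I m).lintegral_comp h₁, lintegral_prod]
  · refine lintegral_congr fun t => lintegral_congr fun t' => ?_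
    congr 1
    ext i
    have : i ∈ I → i ∉ J := fun h => Finset.disjoint_left.1 hIJ h
    by_cases hi : i ∈ I <;> by_cases hj : i ∈ J <;> simp_all
  · exact (h₁.comp (map_piecewise_boxProb I m).measurable).aemeasurable

/-- The family `C` of scales is totally ordered in the directions of `I`. -/
def IsChainOn (I : Finset ι) (C : Set (ι → ℕ)) : Prop :=
  ∀ m ∈ C, ∀ m' ∈ C, (∀ i ∈ I, m i ≤ m' i) ∨ ∀ i ∈ I, m' i ≤ m i

/-- The weak type `(1, 1)` inequality for a totally ordered family of partial averages. -/
lemma volume_lt_partialMaximal_le {I : Finset ι} {C : Set (ι → ℕ)} (hC : IsChainOn I C)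
    {g : (ι → ℝ) → ENNReal} (hg : Measurable g) {s : ENNReal} (hs : s ≠ 0) (hs' : s ≠ ⊤) :
    volume {x | s < partialMaximal I C g x} ≤
      2 ^ Fintype.card ι * s⁻¹ * ∫⁻ x, g x := by
  let _ : Fintype {i // i ∈ I} := Subtype.fintype (· ∈ I)
  let e := MeasurableEquiv.piEquivPiSubtypeProd (fun _ : ι => ℝ) (· ∈ I)
  have he : MeasurePreserving e volume volume :=
    volume_preserving_piEquivPiSubtypeProd (fun _ : ι => ℝ) (· ∈ I)
  have hE : MeasurableSet {x | s < partialMaximal I C g x} :=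
    measurableSet_lt measurable_const (measurable_partialMaximal I C hg)
  have hslice (u : {i // i ∈ I} → ℝ) (y : {i // i ∉ I} → ℝ) (m : ι → ℕ) :
      partialAverage I m g (e.symm (u, y)) =
        ∫⁻ t, g (e.symm (u + t, y)) ∂boxProb fun i : {i // i ∈ I} => m i := by
    have hm := measurePreserving_piEquivPiSubtypeProd (fun i => unifInterval (m i)) (· ∈ I)
    have h₂ : Measurable fun t : {i // i ∈ I} → ℝ => g (e.symm (u + t, y)) :=
      hg.comp (e.symm.measurable.comp
        ((measurable_id.const_add u).prodMk measurable_const))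
    have hfst : MeasurePreserving (fun t : ι → ℝ => (e t).1) (boxProb m)
        (boxProb fun i : {i // i ∈ I} => m i) :=
      measurePreserving_fst.comp hm
    rw [partialAverage, ← hfst.lintegral_comp h₂]
    refine lintegral_congr fun t => ?_
    congr 1
    ext i
    by_cases hi : i ∈ I <;>
      simp [e, hi, MeasurableEquiv.piEquivPiSubtypeProd, Equiv.piEquivPiSubtypeProd]
  let C' : Set ({i // i ∈ I} → ℕ) := (fun m i => m i) '' C
  have hC' : IsChain (· ≤ ·) C' := by
    rintro _ ⟨m, hm, rfl⟩ _ ⟨m', hm', rfl⟩ _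
    rcases hC m hm m' hm' with h | h
    · exact Or.inl fun i => h i i.2
    · exact Or.inr fun i => h i i.2
  have hcard : (2 : ENNReal) ^ Fintype.card {i // i ∈ I} ≤ 2 ^ Fintype.card ι :=
    pow_le_pow_right₀ one_le_two (Fintype.card_subtype_le _)
  rw [← he.symm.measure_preimage hE.nullMeasurableSet, Measure.volume_eq_prod,
    Measure.prod_apply_symm (e.symm.measurable hE)]
  calc _ ≤ ∫⁻ y, 2 ^ Fintype.card ι * s⁻¹ * ∫⁻ u, g (e.symm (u, y)) := by
        refine lintegral_mono fun y => ?_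
        refine le_trans (measure_mono ?_) ((volume_lt_average_le C' hC'
          (fun u => g (e.symm (u, y))) s hs hs').trans ?_)
        · intro u hu
          simp only [Set.mem_preimage, Set.mem_ofPred_eq, partialMaximal, lt_iSup_iff] at hu
          obtain ⟨m, hm, hlt⟩ := hu
          exact ⟨_, ⟨m, hm, rfl⟩, (hslice u y m) ▸ hlt⟩
        · gcongr
    _ = 2 ^ Fintype.card ι * s⁻¹ * ∫⁻ x, g x := by
        have hge : Measurable fun p => g (e.symm p) := hg.comp e.symm.measurable
        rw [lintegral_const_mul _ hge.lintegral_prod_left', ← lintegral_prod_symm' _ hge]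
        congr 1
        exact he.symm.lintegral_comp hg

/-- The weak type inequality in which only the large values of the function contribute. -/
lemma volume_lt_partialMaximal_le_setLIntegral {I : Finset ι} {C : Set (ι → ℕ)}
    (hC : IsChainOn I C) {g : (ι → ℝ) → ENNReal} (hg : Measurable g) {s : ENNReal}
    (hs : s ≠ 0) (hs' : s ≠ ⊤) :
    volume {x | 2 * s < partialMaximal I C g x} ≤
      2 ^ Fintype.card ι * s⁻¹ * ∫⁻ x in {x | s < g x}, g x := by
  have hS : MeasurableSet {x | s < g x} := measurableSet_lt measurable_const hg
  rw [← lintegral_indicator hS]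
  refine le_trans (measure_mono fun x hx => ?_)
    (volume_lt_partialMaximal_le hC (hg.indicator hS) hs hs')
  simp only [Set.mem_ofPred_eq, partialMaximal, lt_iSup_iff] at hx ⊢
  obtain ⟨m, hm, hlt⟩ := hx
  refine ⟨m, hm, ?_⟩
  have hle : partialAverage I m g x ≤
      partialAverage I m ({x | s < g x}.indicator g) x + s := by
    calc partialAverage I m g x
        ≤ ∫⁻ t, ({x | s < g x}.indicator g (x + I.piecewise t 0) + s) ∂boxProb m := by
          refine lintegral_mono fun t => ?_
          by_cases h : s < g (x + I.piecewise t 0)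
          · simp [Set.indicator, h]
          · simpa [Set.indicator, h] using not_lt.1 h
      _ = _ := by
          rw [lintegral_add_right _ measurable_const]
          simp [partialAverage]
  rw [two_mul] at hlt
  exact lt_of_add_lt_add_right (hlt.trans_le hle)

end Partial

/-- A discrete version of the Orlicz function `u ↦ u (log₊ u) ^ k`. -/
noncomputable def dyadicOrlicz (k : ℕ) (u : ENNReal) : ENNReal :=
  ∑' j : ℕ, ((j : ENNReal) + 1) ^ k * if 2 ^ j < u then 2 ^ j else 0

lemma measurable_dyadicOrlicz (k : ℕ) : Measurable (dyadicOrlicz k) := by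
  refine Measurable.tsum fun j => ?_
  exact (Measurable.ite measurableSet_Ioi measurable_const measurable_const).const_mul _

lemma exists_two_pow_lt_le {u : ENNReal} (hu : 1 < u) (hu' : u ≠ ⊤) :
    ∃ N : ℕ, 2 ^ N < u ∧ u ≤ 2 ^ (N + 1) := by
  have hex : ∃ N : ℕ, u ≤ 2 ^ N := by
    lift u to NNReal using hu'
    obtain ⟨N, hN⟩ := pow_unbounded_of_one_lt u (one_lt_two : (1 : NNReal) < 2)
    exact ⟨N, by exact_mod_cast hN.le⟩
  classical
  have hne : Nat.find hex ≠ 0 := fun h => by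
    have := Nat.find_spec hex
    rw [h, pow_zero] at this
    exact absurd hu this.not_gt
  obtain ⟨N, hN⟩ := Nat.exists_eq_succ_of_ne_zero hne
  exact ⟨N, not_le.1 (Nat.find_min hex (hN ▸ Nat.lt_succ_self N)), by
    have := Nat.find_spec hex
    rwa [hN] at this⟩

lemma dyadicOrlicz_top (k : ℕ) : dyadicOrlicz k ⊤ = ⊤ := by
  refine top_le_iff.1 ?_
  calc (⊤ : ENNReal) = ∑' _ : ℕ, 1 := (ENNReal.tsum_const_eq_top_of_ne_zero one_ne_zero).symm
    _ ≤ dyadicOrlicz k ⊤ := by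
      refine ENNReal.tsum_le_tsum fun j => ?_
      rw [if_pos (by finiteness)]
      exact one_le_mul (one_le_pow₀ (by simp)) (one_le_pow₀ one_le_two)

lemma le_dyadicOrlicz {k N : ℕ} {u : ENNReal} (h : 2 ^ N < u) :
    ((N : ENNReal) + 1) ^ k * 2 ^ N ≤ dyadicOrlicz k u := by
  refine le_trans ?_ (ENNReal.le_tsum N)
  rw [if_pos h]

lemma le_dyadicOrlicz_zero {u : ENNReal} (hu : 1 < u) : u ≤ 2 * dyadicOrlicz 0 u := by
  rcases eq_or_ne u ⊤ with rfl | hu'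
  · simp [dyadicOrlicz_top]
  obtain ⟨N, h₁, h₂⟩ := exists_two_pow_lt_le hu hu'
  refine h₂.trans ?_
  rw [pow_succ']
  gcongr
  simpa using le_dyadicOrlicz (k := 0) h₁

/-- Only the terms with `j ≤ N` contribute to a sum over the powers `2 ^ j < u ≤ 2 ^ (N + 1)`. -/
lemma tsum_ite_two_pow_lt {N : ℕ} {u : ENNReal} (hu : u ≤ 2 ^ (N + 1)) (w v : ℕ → ENNReal) :
    ∑' j : ℕ, w j * (if 2 ^ j < u then v j else 0) ≤
      ∑ j ∈ Finset.range (N + 1), w j * v j := by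
  rw [tsum_eq_sum (s := Finset.range (N + 1))]
  · refine Finset.sum_le_sum fun j _ => ?_
    gcongr
    split_ifs <;> simp
  · intro j hj
    rw [if_neg, mul_zero]
    rw [Finset.mem_range, not_lt] at hj
    exact not_lt.2 (hu.trans (pow_le_pow_right₀ one_le_two hj))

lemma tsum_ite_two_pow_lt_eq_zero {u : ENNReal} (hu : u ≤ 1) (w v : ℕ → ENNReal) :
    ∑' j : ℕ, w j * (if 2 ^ j < u then v j else 0) = 0 := by
  refine ENNReal.tsum_eq_zero.2 fun j => ?_
  rw [if_neg (not_lt.2 (hu.trans (one_le_pow₀ one_le_two))), mul_zero]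

lemma mul_tsum_le_dyadicOrlicz (k : ℕ) (u : ENNReal) :
    u * ∑' j : ℕ, ((j : ENNReal) + 1) ^ k * (if 2 ^ j < u then 1 else 0) ≤
      2 * dyadicOrlicz (k + 1) u := by
  rcases le_or_gt u 1 with hu | hu
  · rw [tsum_ite_two_pow_lt_eq_zero hu (fun j => ((j : ENNReal) + 1) ^ k) fun _ => 1, mul_zero]
    exact zero_le
  rcases eq_or_ne u ⊤ with rfl | hu'
  · simp [dyadicOrlicz_top]
  obtain ⟨N, h₁, h₂⟩ := exists_two_pow_lt_le hu hu'
  calc u * ∑' j : ℕ, ((j : ENNReal) + 1) ^ k * (if 2 ^ j < u then 1 else 0)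
      ≤ 2 ^ (N + 1) * ∑ j ∈ Finset.range (N + 1), ((N : ENNReal) + 1) ^ k := by
        gcongr
        refine (tsum_ite_two_pow_lt h₂ _ _).trans (Finset.sum_le_sum fun j hj => ?_)
        rw [mul_one]
        gcongr
        exact Nat.lt_succ_iff.1 (Finset.mem_range.1 hj)
    _ = 2 * (((N : ENNReal) + 1) ^ (k + 1) * 2 ^ N) := by
        rw [Finset.sum_const, Finset.card_range, nsmul_eq_mul]
        push_cast
        ring
    _ ≤ _ := by
        gcongr
        exact le_dyadicOrlicz h₁

lemma dyadicOrlicz_le_of_two_pow_lt (d : ℕ) {N : ℕ} {u : ENNReal} (h₁ : 2 ^ N < u)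
    (h₂ : u ≤ 2 ^ (N + 1)) : dyadicOrlicz d u ≤ ((N : ENNReal) + 1) ^ d * (2 * u) := by
  calc dyadicOrlicz d u ≤ ∑ j ∈ Finset.range (N + 1), ((N : ENNReal) + 1) ^ d * 2 ^ j := by
        refine (tsum_ite_two_pow_lt h₂ _ _).trans (Finset.sum_le_sum fun j hj => ?_)
        gcongr
        exact Nat.lt_succ_iff.1 (Finset.mem_range.1 hj)
    _ ≤ ((N : ENNReal) + 1) ^ d * (2 * u) := by
        rw [← Finset.mul_sum]
        gcongr
        calc ∑ j ∈ Finset.range (N + 1), (2 : ENNReal) ^ j ≤ 2 ^ (N + 1) := by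
              exact_mod_cast (Nat.geomSum_lt le_rfl fun j hj => Finset.mem_range.1 hj).le
          _ ≤ 2 * u := by
              rw [pow_succ']
              gcongr

lemma dyadicOrlicz_le (d : ℕ) (a : ℝ) (ha : 1 ≤ a) : ∃ c : ℝ, 0 < c ∧ ∀ u : ℝ, 0 ≤ u →
    dyadicOrlicz d (ENNReal.ofReal (a * u)) ≤
      ENNReal.ofReal c * ENNReal.ofReal (u * (1 + Real.posLog u ^ d)) := by
  set b : ℝ := 1 + 2 * Real.log a with hb
  have hb0 : 1 ≤ b := by linarith [Real.log_nonneg ha]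
  refine ⟨2 ^ (d - 1) * (b ^ d + 2 ^ d) * (2 * a), by positivity, fun u hu => ?_⟩
  have hpos : 0 ≤ Real.posLog u := Real.posLog_nonneg
  rcases le_or_gt (ENNReal.ofReal (a * u)) 1 with h | h
  · rw [dyadicOrlicz, tsum_ite_two_pow_lt_eq_zero h]
    exact zero_le
  obtain ⟨N, h₁, h₂⟩ := exists_two_pow_lt_le h ENNReal.ofReal_ne_top
  have hN : (2 : ℝ) ^ N < a * u := by
    have : ENNReal.ofReal (2 ^ N) < ENNReal.ofReal (a * u) := by
      rwa [ENNReal.ofReal_pow zero_le_two, ENNReal.ofReal_ofNat]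
    exact (ENNReal.ofReal_lt_ofReal_iff_of_nonneg (by positivity)).1 this
  have hu0 : 0 < u := by
    have : (0 : ℝ) < 2 ^ N := by positivity
    by_contra! hcon
    nlinarith
  have hNle : (N : ℝ) + 1 ≤ b + 2 * Real.posLog u := by
    have h3 : N * Real.log 2 ≤ Real.log a + Real.log u := by
      rw [← Real.log_pow, ← Real.log_mul (by positivity) hu0.ne']
      exact Real.log_le_log (by positivity) hN.le
    have h4 : Real.log u ≤ Real.posLog u := le_max_right _ _
    have h5 : (1 / 2 : ℝ) ≤ Real.log 2 := by linarith [Real.log_two_gt_d9]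
    have h6 : (N : ℝ) * (1 / 2) ≤ N * Real.log 2 := by gcongr
    linarith
  calc dyadicOrlicz d (ENNReal.ofReal (a * u))
      ≤ ((N : ENNReal) + 1) ^ d * (2 * ENNReal.ofReal (a * u)) :=
        dyadicOrlicz_le_of_two_pow_lt d h₁ h₂
    _ = ENNReal.ofReal (((N : ℝ) + 1) ^ d * (2 * (a * u))) := by
        rw [ENNReal.ofReal_mul (p := ((N : ℝ) + 1) ^ d) (by positivity),
          ENNReal.ofReal_pow (by positivity), ENNReal.ofReal_add (by positivity) zero_le_one, ENNReal.ofReal_natCast,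
          ENNReal.ofReal_one, ENNReal.ofReal_mul zero_le_two, ENNReal.ofReal_ofNat]
    _ ≤ _ := by
        rw [← ENNReal.ofReal_mul (by positivity)]
        refine ENNReal.ofReal_le_ofReal ?_
        calc ((N : ℝ) + 1) ^ d * (2 * (a * u))
            ≤ (2 ^ (d - 1) * (b ^ d + (2 * Real.posLog u) ^ d)) * (2 * (a * u)) := by
              gcongr
              refine (pow_le_pow_left₀ (by positivity) hNle d).trans ?_
              exact add_pow_le (by positivity) (by positivity) d
          _ ≤ (2 ^ (d - 1) * ((b ^ d + 2 ^ d) * (1 + Real.posLog u ^ d))) * (2 * (a * u)) := by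
              gcongr
              rw [mul_pow]
              have h7 : 0 ≤ b ^ d * Real.posLog u ^ d := by positivity
              have h8 : (0 : ℝ) ≤ 2 ^ d := by positivity
              linarith
          _ = _ := by ring

lemma measurable_dyadicOrlicz_two_mul {E : Type*} [MeasurableSpace E] {g : E → ENNReal}
    (hg : Measurable g) (k : ℕ) : Measurable fun x => dyadicOrlicz k (2 * g x) :=
  (measurable_dyadicOrlicz k).comp (hg.const_mul 2)

section Iteration

variable {ι : Type*} [Fintype ι] [DecidableEq ι]

lemma lintegral_dyadicOrlicz_partialMaximal_le {I : Finset ι} {C : Set (ι → ℕ)}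
    (hC : IsChainOn I C) {g : (ι → ℝ) → ENNReal} (hg : Measurable g) (k : ℕ) :
    ∫⁻ x, dyadicOrlicz k (partialMaximal I C g x) ≤
      2 ^ (Fintype.card ι + 1) * ∫⁻ x, dyadicOrlicz (k + 1) (2 * g x) := by
  have hT := measurable_partialMaximal I C hg
  have hmeas (j : ℕ) : Measurable fun x => (if 2 ^ j < 2 * g x then (1 : ENNReal) else 0) :=
    Measurable.ite (measurableSet_lt measurable_const (hg.const_mul 2))
      measurable_const measurable_const
  calc ∫⁻ x, dyadicOrlicz k (partialMaximal I C g x)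
      = ∑' j : ℕ, ((j : ENNReal) + 1) ^ k * (2 ^ j * volume {x | 2 ^ j < partialMaximal I C g x}) := by
        unfold dyadicOrlicz
        have hSj (j : ℕ) : MeasurableSet {x | 2 ^ j < partialMaximal I C g x} :=
          measurableSet_lt measurable_const hT
        have hi (j : ℕ) : Measurable fun x =>
            if 2 ^ j < partialMaximal I C g x then (2 : ENNReal) ^ j else 0 :=
          Measurable.ite (hSj j) measurable_const measurable_const
        rw [lintegral_tsum fun j => ((hi j).const_mul _).aemeasurable]
        refine tsum_congr fun j => ?_
        rw [lintegral_const_mul _ (hi j), ← lintegral_indicator_const (hSj j)]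
        simp [Set.indicator]
    _ ≤ ∑' j : ℕ, ((j : ENNReal) + 1) ^ k * (2 ^ Fintype.card ι *
          ∫⁻ x, 2 * g x * if 2 ^ j < 2 * g x then 1 else 0) := by
        refine ENNReal.tsum_le_tsum fun j => ?_
        refine mul_le_mul' le_rfl ?_
        have h2 : (2 : ENNReal) * (2 ^ j / 2) = 2 ^ j :=
          ENNReal.mul_div_cancel (by simp) (by simp)
        have hw := volume_lt_partialMaximal_le_setLIntegral hC hg (s := 2 ^ j / 2)
          (by simp) (ENNReal.div_ne_top (by simp) (by simp))
        rw [h2] at hw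
        have hset : MeasurableSet {x | 2 ^ j / 2 < g x} := measurableSet_lt measurable_const hg
        calc 2 ^ j * volume {x | 2 ^ j < partialMaximal I C g x}
            ≤ 2 ^ j * (2 ^ Fintype.card ι * (2 ^ j / 2)⁻¹ *
                ∫⁻ x in {x | 2 ^ j / 2 < g x}, g x) := by gcongr
          _ = 2 ^ Fintype.card ι * (2 * ∫⁻ x in {x | 2 ^ j / 2 < g x}, g x) := by
            rw [ENNReal.inv_div (by simp) (by simp), ENNReal.div_eq_inv_mul]
            have : (2 : ENNReal) ^ j * (2 ^ j)⁻¹ = 1 :=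
              ENNReal.mul_inv_cancel (by simp) (by simp)
            calc _ = (2 ^ j * (2 ^ j)⁻¹) * (2 ^ Fintype.card ι *
                  (2 * ∫⁻ x in {x | 2 ^ j / 2 < g x}, g x)) := by ring
              _ = _ := by rw [this, one_mul]
          _ = _ := by
            rw [← lintegral_indicator hset, ← lintegral_const_mul _ (hg.indicator hset)]
            congr 1
            refine lintegral_congr fun x => ?_
            have : 2 ^ j / 2 < g x ↔ 2 ^ j < 2 * g x := by
              rw [ENNReal.div_lt_iff (by simp) (by simp), mul_comm]
            simp [Set.indicator, this]
    _ = 2 ^ Fintype.card ι * ∫⁻ x, 2 * g x *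
          ∑' j : ℕ, ((j : ENNReal) + 1) ^ k * (if 2 ^ j < 2 * g x then 1 else 0) := by
        have hm (j : ℕ) : Measurable fun x => 2 * g x * (if 2 ^ j < 2 * g x then (1 : ENNReal) else 0) :=
          (hg.const_mul 2).mul (hmeas j)
        simp_rw [mul_left_comm _ ((2 : ENNReal) ^ Fintype.card ι)]
        rw [ENNReal.tsum_mul_left]
        simp_rw [← lintegral_const_mul _ (hm _)]
        rw [← lintegral_tsum fun j => ((hm j).const_mul _).aemeasurable]
        congr 1
        refine lintegral_congr fun x => ?_
        rw [← ENNReal.tsum_mul_left]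
        exact tsum_congr fun j => mul_left_comm _ _ _
    _ ≤ 2 ^ Fintype.card ι * ∫⁻ x, 2 * dyadicOrlicz (k + 1) (2 * g x) := by
        exact mul_le_mul' le_rfl (lintegral_mono fun x => mul_tsum_le_dyadicOrlicz k _)
    _ = _ := by
        rw [lintegral_const_mul _ (measurable_dyadicOrlicz_two_mul hg _), pow_succ,
          mul_assoc]

lemma volume_one_lt_partialMaximal_le {I : Finset ι} {C : Set (ι → ℕ)}
    (hC : IsChainOn I C) {g : (ι → ℝ) → ENNReal} (hg : Measurable g) :
    volume {x | 1 < partialMaximal I C g x} ≤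
      2 ^ (Fintype.card ι + 1) * ∫⁻ x, dyadicOrlicz 0 (2 * g x) := by
  have hw := volume_lt_partialMaximal_le_setLIntegral hC hg (s := 2⁻¹) (by simp) (by simp)
  rw [ENNReal.mul_inv_cancel (by simp) (by simp), inv_inv] at hw
  refine hw.trans ?_
  have hset : MeasurableSet {x | 2⁻¹ < g x} := measurableSet_lt measurable_const hg
  rw [mul_assoc, pow_succ, mul_assoc, ← lintegral_const_mul _ hg,
    ← lintegral_const_mul _ (measurable_dyadicOrlicz_two_mul hg _),
    ← lintegral_indicator hset]
  refine mul_le_mul' le_rfl (lintegral_mono ?_)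
  refine Set.indicator_le (fun x hx => le_dyadicOrlicz_zero ?_)
  rw [Set.mem_ofPred_eq, ← one_div, ENNReal.div_lt_iff (by simp) (by simp)] at hx
  rwa [mul_comm]

/-- Iterating one-dimensional maximal operators in the directions of `J`. -/
lemma exists_dominating_partialAverage (J : Finset ι) {g : (ι → ℝ) → ENNReal}
    (hg : Measurable g) :
    ∃ h : (ι → ℝ) → ENNReal, Measurable h ∧ (∀ m x, partialAverage J m g x ≤ h x) ∧
      ∀ (k : ℕ) (c : ENNReal), ∫⁻ x, dyadicOrlicz k (c * h x) ≤
        (2 ^ (Fintype.card ι + 1)) ^ J.card *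
          ∫⁻ x, dyadicOrlicz (k + J.card) (2 ^ J.card * c * g x) := by
  induction J using Finset.induction_on with
  | empty => exact ⟨g, hg, fun m x => (partialAverage_empty m g x).le, fun k c => by simp⟩
  | insert a J ha ih =>
    obtain ⟨h, hh, hle, hint⟩ := ih
    refine ⟨partialMaximal {a} Set.univ h, measurable_partialMaximal _ _ hh, fun m x => ?_,
      fun k c => ?_⟩
    · rw [Finset.insert_eq, partialAverage_union (Finset.disjoint_singleton_left.2 ha) m hg]
      exact (partialAverage_mono _ _ (hle m) x).trans
        (le_iSup₂ (f := fun m _ => partialAverage {a} m h x) m trivial)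
    · have hchain : IsChainOn {a} (Set.univ : Set (ι → ℕ)) := fun m _ m' _ => by
        simpa using le_total (m a) (m' a)
      have h1 := lintegral_dyadicOrlicz_partialMaximal_le hchain (hh.const_mul c) k
      simp only [partialMaximal_const_mul _ _ hh, ← mul_assoc] at h1
      refine h1.trans ?_
      rw [Finset.card_insert_of_notMem ha, pow_succ' (2 ^ (Fintype.card ι + 1)), mul_assoc]
      refine mul_le_mul' le_rfl ?_
      refine (hint (k + 1) (2 * c)).trans_eq ?_
      rw [add_assoc, add_comm 1]
      simp only [pow_succ, mul_assoc]

lemma volume_one_lt_partialAverage_univ_le {I : Finset ι} {C : Set (ι → ℕ)}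
    (hC : IsChainOn I C) {g : (ι → ℝ) → ENNReal} (hg : Measurable g) :
    volume {x | ∃ m ∈ C, 1 < partialAverage Finset.univ m g x} ≤
      (2 ^ (Fintype.card ι + 1)) ^ (Iᶜ.card + 1) *
        ∫⁻ x, dyadicOrlicz Iᶜ.card (2 ^ (Iᶜ.card + 1) * g x) := by
  obtain ⟨h, hh, hle, hint⟩ := exists_dominating_partialAverage Iᶜ hg
  calc volume {x | ∃ m ∈ C, 1 < partialAverage Finset.univ m g x}
      ≤ volume {x | 1 < partialMaximal I C h x} := by
        refine measure_mono ?_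
        rintro x ⟨m, hm, hlt⟩
        rw [← Finset.union_compl I, partialAverage_union disjoint_compl_right m hg] at hlt
        exact hlt.trans_le ((partialAverage_mono _ _ (hle m) x).trans
          (le_iSup₂ (f := fun m _ => partialAverage I m h x) m hm))
    _ ≤ _ := volume_one_lt_partialMaximal_le hC hh
    _ ≤ _ := by
        rw [pow_succ' (2 ^ (Fintype.card ι + 1)), mul_assoc]
        refine mul_le_mul' le_rfl ?_
        refine (hint 0 2).trans_eq ?_
        simp only [zero_add, pow_succ]

end Iteration

/-- The standard dyadic rectangle with side lengths `2 ^ (-m i)`. -/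
def dyadicRectangle {n : ℕ} (m : Fin n → ℕ) : Set (Fin n → ℝ) :=
  Set.univ.pi fun i => Set.Icc (0 : ℝ) ((2 ^ m i)⁻¹)

lemma volume_centredBox_one_eq {n : ℕ} (x : Fin n → ℝ) (m : Fin n → ℕ) :
    volume (centredBox 1 x m) = 2 ^ n * volume (dyadicRectangle m) := by
  rw [volume_centredBox, dyadicRectangle, volume_pi_pi]
  simp only [Real.volume_Icc, one_mul, sub_zero, ENNReal.ofReal_mul zero_le_two,
    Finset.prod_mul_distrib, Finset.prod_const, Finset.card_univ, Fintype.card_fin,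
    ENNReal.ofReal_ofNat]

lemma inv_volume_mul_setLIntegral_translate_le {n : ℕ} (m : Fin n → ℕ)
    (g : (Fin n → ℝ) → ENNReal) {v x : Fin n → ℝ}
    (hx : x ∈ (fun y => v + y) '' dyadicRectangle m) :
    (volume (dyadicRectangle m))⁻¹ * ∫⁻ y in (fun y => v + y) '' dyadicRectangle m, g y ≤
      2 ^ n * partialAverage Finset.univ m g x := by
  have hsub : (fun y => v + y) '' dyadicRectangle m ⊆ centredBox 1 x m := by
    obtain ⟨w, hw, rfl⟩ := hx
    rintro _ ⟨z, hz, rfl⟩ i _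
    have h1 := hw i trivial
    have h2 := hz i trivial
    simp only [Set.mem_Icc, Pi.add_apply] at h1 h2 ⊢
    constructor <;> linarith
  have havg : partialAverage Finset.univ m g x =
      (volume (centredBox 1 x m))⁻¹ * ∫⁻ y in centredBox 1 x m, g y := by
    rw [← lintegral_boxProb_add]
    simp [partialAverage]
  rw [havg, volume_centredBox_one_eq, ENNReal.mul_inv (by simp) (by simp), ← mul_assoc,
    ← mul_assoc, ENNReal.mul_inv_cancel (by simp) (by simp), one_mul]
  gcongr

lemma lt_maximalOperator_imp {n : ℕ} {F : Set (Set (Fin n → ℝ))}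
    (hF : ∀ R ∈ F, IsStandardDyadicRectangle R) {f : (Fin n → ℝ) → ℝ}
    {g : (Fin n → ℝ) → ENNReal}
    {t : ℝ} (ht : 0 < t) (hfg : ∀ᵐ y, ENNReal.ofReal (2 ^ n * (|f y| / t)) = g y)
    {x : Fin n → ℝ} (hx : ENNReal.ofReal t < maximalOperator F f x) :
    ∃ m, dyadicRectangle m ∈ F ∧ 1 < partialAverage Finset.univ m g x := by
  simp only [maximalOperator, lt_iSup_iff] at hx
  obtain ⟨R, hR, v, hxv, hlt⟩ := hx
  obtain ⟨m, rfl⟩ := hF R hR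
  change x ∈ (fun y => v + y) '' dyadicRectangle m at hxv
  refine ⟨m, hR, ?_⟩
  have ht0 : ENNReal.ofReal t ≠ 0 := by simpa using ht
  have hle := inv_volume_mul_setLIntegral_translate_le m g hxv
  have heq : ∫⁻ y in (fun y => v + y) '' dyadicRectangle m, g y =
      2 ^ n * (ENNReal.ofReal t)⁻¹ *
        ∫⁻ y in (fun y => v + y) '' dyadicRectangle m, ENNReal.ofReal |f y| := by
    rw [← lintegral_const_mul' _ _ (by finiteness)]
    refine lintegral_congr_ae (ae_restrict_of_ae (hfg.mono fun y hy => ?_))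
    simp only
    rw [← hy, ENNReal.ofReal_mul (by positivity), ENNReal.ofReal_div_of_pos ht,
      ENNReal.ofReal_pow zero_le_two, ENNReal.ofReal_ofNat, ENNReal.div_eq_inv_mul, mul_assoc]
  rw [heq, mul_left_comm, mul_assoc] at hle
  have hle' := (ENNReal.mul_le_mul_iff_right (by simp) (by simp)).1 hle
  refine lt_of_lt_of_le ?_ hle'
  rw [← ENNReal.div_eq_inv_mul, ENNReal.lt_div_iff_mul_lt (Or.inl ht0) (by simp),
    one_mul]
  exact hlt

lemma le_of_coordPlaneProj_subset {n : ℕ} {i j : Fin n} {m m' : Fin n → ℕ}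
    (h : coordPlaneProj i j '' dyadicRectangle m ⊆ coordPlaneProj i j '' dyadicRectangle m') :
    m' i ≤ m i ∧ m' j ≤ m j := by
  have hmem : (fun k => ((2 : ℝ) ^ m k)⁻¹) ∈ dyadicRectangle m :=
    fun k _ => ⟨by positivity, le_rfl⟩
  obtain ⟨y, hy, hyx⟩ := h ⟨_, hmem, rfl⟩
  have key (k : Fin n) (hk : y k = ((2 : ℝ) ^ m k)⁻¹) : m' k ≤ m k := by
    have h1 := (hy k trivial).2
    rw [hk, inv_le_inv₀ (by positivity) (by positivity)] at h1
    exact (pow_le_pow_iff_right₀ one_lt_two).1 h1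
  exact ⟨key i (by simpa [coordPlaneProj] using congrFun hyx 0),
    key j (by simpa [coordPlaneProj] using congrFun hyx 1)⟩

theorem mainTheorem4 (n : ℕ) (hn : 2 ≤ n) (F : Set (Set (Fin n → ℝ)))
    (hF : ∀ R ∈ F, IsStandardDyadicRectangle R)
    (hproj : ∃ i j : Fin n, i ≠ j ∧
      HasFiniteWidth ((fun R : Set (Fin n → ℝ) => coordPlaneProj i j '' R) '' F)) :
    ∃ c : ℝ, 0 < c ∧
      ∀ f : (Fin n → ℝ) → ℝ, AEMeasurable f volume → ∀ t : ℝ, 0 < t →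
        volume {x | ENNReal.ofReal t < maximalOperator F f x} ≤
          ENNReal.ofReal c * ∫⁻ x, ENNReal.ofReal
            (|f x| / t * (1 + Real.posLog (|f x| / t) ^ (n - 2))) := by
  obtain ⟨i, j, hij, N, C, hC, hFC⟩ := hproj
  have hcard : ({i, j} : Finset (Fin n))ᶜ.card = n - 2 := by
    rw [Finset.card_compl, Finset.card_pair hij, Fintype.card_fin]
  obtain ⟨c, hc, hcle⟩ := dyadicOrlicz_le (n - 2) (2 ^ (n - 2 + 1) * 2 ^ n)
    (one_le_mul_of_one_le_of_one_le (one_le_pow₀ one_le_two) (one_le_pow₀ one_le_two))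
  refine ⟨(N + 1) * ((2 ^ (n + 1)) ^ (n - 2 + 1) * c), by positivity, fun f hf t ht => ?_⟩
  obtain ⟨g, hg, hfg⟩ : AEMeasurable (fun y => ENNReal.ofReal (2 ^ n * (|f y| / t))) volume := by
    fun_prop
  let S : Fin N → Set (Fin n → ℕ) := fun k =>
    {m | coordPlaneProj i j '' dyadicRectangle m ∈ C k}
  have hS (k : Fin N) : IsChainOn {i, j} (S k) := by
    intro m hm m' hm'
    rcases (hC k).total hm hm' with h | h
    · exact Or.inr (by simpa using le_of_coordPlaneProj_subset h)
    · exact Or.inl (by simpa using le_of_coordPlaneProj_subset h)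
  have hbound (k : Fin N) : volume {x | ∃ m ∈ S k, 1 < partialAverage Finset.univ m g x} ≤
      ENNReal.ofReal ((2 ^ (n + 1)) ^ (n - 2 + 1) * c) * ∫⁻ x, ENNReal.ofReal
        (|f x| / t * (1 + Real.posLog (|f x| / t) ^ (n - 2))) := by
    refine (volume_one_lt_partialAverage_univ_le (hS k) hg).trans ?_
    rw [hcard, Fintype.card_fin, ENNReal.ofReal_mul (by positivity),
      ENNReal.ofReal_pow (by positivity), ENNReal.ofReal_pow zero_le_two, ENNReal.ofReal_ofNat,
      mul_assoc, ← lintegral_const_mul' _ _ ENNReal.ofReal_ne_top]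
    refine mul_le_mul' le_rfl (lintegral_mono_ae (hfg.mono fun x hx => ?_))
    refine le_of_eq_of_le ?_ (hcle (|f x| / t) (by positivity))
    rw [← hx, mul_assoc, ENNReal.ofReal_mul (by positivity : (0 : ℝ) ≤ 2 ^ (n - 2 + 1)),
      ENNReal.ofReal_pow zero_le_two, ENNReal.ofReal_ofNat]
  have hsub : {x | ENNReal.ofReal t < maximalOperator F f x} ⊆
      ⋃ k, {x | ∃ m ∈ S k, 1 < partialAverage Finset.univ m g x} := by
    intro x hx
    obtain ⟨m, hm, hlt⟩ := lt_maximalOperator_imp hF ht hfg hx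
    have hmem : coordPlaneProj i j '' dyadicRectangle m ∈ ⋃ k, C k := hFC ▸ ⟨_, hm, rfl⟩
    obtain ⟨k, hk⟩ := Set.mem_iUnion.1 hmem
    exact Set.mem_iUnion.2 ⟨k, m, hk, hlt⟩
  calc volume {x | ENNReal.ofReal t < maximalOperator F f x}
      ≤ ∑ k, volume {x | ∃ m ∈ S k, 1 < partialAverage Finset.univ m g x} :=
        (measure_mono hsub).trans (measure_iUnion_fintype_le _ _)
    _ ≤ _ := Finset.sum_le_sum fun k _ => hbound k
    _ ≤ _ := by
        rw [Finset.sum_const, Finset.card_univ, Fintype.card_fin, nsmul_eq_mul, ← mul_assoc,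
          ENNReal.ofReal_mul (by positivity : (0 : ℝ) ≤ N + 1)]
        gcongr
        rw [ENNReal.ofReal_add (by positivity) zero_le_one, ENNReal.ofReal_natCast]
        exact le_self_add
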